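/- For a sequence $A=(a_1,\dots,a_n)$ of distinct real numbers let $a_i^+$ (resp. $a_i^-$) be the length of the longest increasing (resp. decreasing) subsequence of $A$ that ends at $a_i$. The Erdős–Szekeres tableau (EST) of $A$ is the sequence of points $T(A)=\big((a_i^+,a_i^-)\big)_{1\le i\le n}$, and $\mathcal T_n$ denotes the set of all ESTs of sequences of $n$ distinct real numbers. Regard such a sequence $A$ as the strict linear order $<_A$ on $[n]=\{1,\dots,n\}$ given by $i<_A j$ if and only if $a_i<a_j$. For $T\in\mathcal T_n$ let $[T]$ be the set of all linear orders $<_A$ on $[n]$ with $T(A)=T$, and let $P(T)=([n],<_{P(T)})$ be the order poset of $T$, where $i<_{P(T)}j$ if and only if $i<_A j$ for every $A\in[T]$. For a poset $P$ let $L(P)$ be the set of all strict linear orders on its ground set that extend $<_P$. **Theorem (Linear Extension Theorem).** For every $n\ge 0$ and every $T\in\mathcal T_n$, $[T]=L(P(T))$. -/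

import Mathlib

namespace ErdosSzekeres

open Classical in
/-- `a_i⁺`: the length of the longest increasing subsequence of `a` that ends at `a i`.
A subsequence is given by its finite set of indices; it ends at `a i` when `i` is the
largest of these indices. -/
noncomputable def incLength {α : Type*} [LinearOrder α] {n : ℕ} (a : Fin n → α) (i : Fin n) : ℕ :=
  (Finset.univ.filter fun s : Finset (Fin n) =>
    i ∈ s ∧ (∀ j ∈ s, j ≤ i) ∧ StrictMonoOn a (s : Set (Fin n))).sup Finset.card

open Classical in
/-- `a_i⁻`: the length of the longest decreasing subsequence of `a` that ends at `a i`. -/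
noncomputable def decLength {α : Type*} [LinearOrder α] {n : ℕ} (a : Fin n → α) (i : Fin n) : ℕ :=
  (Finset.univ.filter fun s : Finset (Fin n) =>
    i ∈ s ∧ (∀ j ∈ s, j ≤ i) ∧ StrictAntiOn a (s : Set (Fin n))).sup Finset.card

/-- The Erdős–Szekeres tableau `T(a) = ((a_i⁺, a_i⁻))_i` of a sequence `a`. -/
noncomputable def est {α : Type*} [LinearOrder α] {n : ℕ} (a : Fin n → α) : Fin n → ℕ × ℕ :=
  fun i => (incLength a i, decLength a i)

/-- The set of all Erdős–Szekeres tableaux of size `n`, i.e. of all sequences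
of `n` distinct real numbers. -/
def tableaux (n : ℕ) : Set (Fin n → ℕ × ℕ) :=
  {T | ∃ a : Fin n → ℝ, Function.Injective a ∧ est a = T}

/-- The strict order `<_a` on the indices: `i <_a j` if and only if `a i < a j`. -/
def seqOrder {α : Type*} [LinearOrder α] {n : ℕ} (a : Fin n → α) : Fin n → Fin n → Prop :=
  fun i j => a i < a j

/-- The class `[T]`: all sequences generating `T`, a sequence of distinct real numbers being
regarded as the strict linear order `<_a` that it induces on the set of indices. -/
def generatingOrders {n : ℕ} (T : Fin n → ℕ × ℕ) : Set (Fin n → Fin n → Prop) :=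
  {r | ∃ a : Fin n → ℝ, Function.Injective a ∧ est a = T ∧ seqOrder a = r}

/-- The strict order of the order poset `P(T)`: the relations common to all members of `[T]`. -/
def orderPoset {n : ℕ} (T : Fin n → ℕ × ℕ) : Fin n → Fin n → Prop :=
  fun i j => ∀ r ∈ generatingOrders T, r i j

/-- `L(P)`: all strict linear orders on `X` that extend the relation `P`. -/
def linearExtensions {X : Type*} (P : X → X → Prop) : Set (X → X → Prop) :=
  {r | IsStrictTotalOrder X r ∧ ∀ x y, P x y → r x y}

/-- The order poset of a tableau is indeed a (strict) partial order. -/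
theorem orderPoset_isStrictOrder {n : ℕ} {T : Fin n → ℕ × ℕ} (hT : T ∈ tableaux n) :
    IsStrictOrder (Fin n) (orderPoset T) where
  irrefl := by
    intro i hi
    obtain ⟨a, ha, hT⟩ := hT
    exact lt_irrefl (a i) (hi _ ⟨a, ha, hT, rfl⟩)
  trans := by
    rintro i j k hij hjk _ ⟨a, ha, hT, rfl⟩
    exact lt_trans (hij _ ⟨a, ha, hT, rfl⟩) (hjk _ ⟨a, ha, hT, rfl⟩)

end ErdosSzekeres

namespace ErdosSzekeres

section IncLength

variable {α β : Type*} [LinearOrder α] [LinearOrder β] {n : ℕ}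

/-! The relations forced by the lengths $a_i^+$ alone already determine these lengths
(`incLength_eq_of_forall_lt`, by induction on the index). An earlier index on the same or a higher
level is forced above `i`, so $b_i^+$ cannot exceed $a_i^+$; the last earlier index on the preceding
level is forced below `i` (`exists_forced_predecessor`), so $b_i^+$ cannot fall short. Reversing the
order of values gives the same for $a_i^-$. -/

theorem card_le_incLength {a : Fin n → α} {i : Fin n} {s : Finset (Fin n)} (hi : i ∈ s)
    (hmax : ∀ j ∈ s, j ≤ i) (hs : StrictMonoOn a (s : Set (Fin n))) :
    s.card ≤ incLength a i := by
  classical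
  exact Finset.le_sup (f := Finset.card) (by simpa using ⟨hi, hmax, hs⟩)

theorem exists_card_eq_incLength (a : Fin n → α) (i : Fin n) :
    ∃ s : Finset (Fin n), i ∈ s ∧ (∀ j ∈ s, j ≤ i) ∧ StrictMonoOn a (s : Set (Fin n)) ∧
      s.card = incLength a i := by
  classical
  obtain ⟨s, hs, hcard⟩ := Finset.exists_mem_eq_sup
    (Finset.univ.filter fun s : Finset (Fin n) =>
      i ∈ s ∧ (∀ j ∈ s, j ≤ i) ∧ StrictMonoOn a (s : Set (Fin n)))
    ⟨{i}, by simp⟩ Finset.card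
  simp only [Finset.mem_filter, Finset.mem_univ, true_and] at hs
  refine ⟨s, hs.1, hs.2.1, hs.2.2, ?_⟩
  rw [← hcard, incLength]

theorem one_le_incLength (a : Fin n → α) (i : Fin n) : 1 ≤ incLength a i := by
  simpa using card_le_incLength (a := a) (s := {i}) (by simp) (by simp) (by simp)

theorem incLength_lt_incLength {a : Fin n → α} {i j : Fin n} (hij : i < j) (ha : a i < a j) :
    incLength a i < incLength a j := by
  obtain ⟨s, hi, hmax, hs, hcard⟩ := exists_card_eq_incLength a i
  have hj : j ∉ s := fun h => (hmax j h).not_gt hij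
  rw [← hcard, ← Nat.succ_le_iff, Nat.succ_eq_add_one, ← Finset.card_insert_of_notMem hj]
  have hlt : ∀ k ∈ s, k < j := fun k hk => (hmax k hk).trans_lt hij
  have hle : ∀ k ∈ s, a k < a j := fun k hk => (hs.monotoneOn hk hi (hmax k hk)).trans_lt ha
  refine card_le_incLength (Finset.mem_insert_self _ _) ?_ ?_
  · simpa using fun k hk => (hlt k hk).le
  · intro x hx y hy hxy
    simp only [Finset.coe_insert, Set.mem_insert_iff, Finset.mem_coe] at hx hy
    rcases hx with rfl | hx <;> rcases hy with rfl | hy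
    · exact absurd hxy (lt_irrefl _)
    · exact absurd hxy (hlt y hy).not_gt
    · exact hle x hx
    · exact hs hx hy hxy

theorem exists_incLength_add_one_eq {a : Fin n → α} {i : Fin n} (h : 1 < incLength a i) :
    ∃ j < i, a j < a i ∧ incLength a j + 1 = incLength a i := by
  obtain ⟨s, hi, hmax, hs, hcard⟩ := exists_card_eq_incLength a i
  have hcard' := Finset.card_erase_add_one hi
  have hne : (s.erase i).Nonempty := by
    rw [← Finset.card_pos]
    omega
  have hmem := Finset.max'_mem _ hne
  set j := (s.erase i).max' hne
  obtain ⟨hji, hjs⟩ := Finset.mem_erase.1 hmem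
  have hlt : j < i := lt_of_le_of_ne (hmax j hjs) hji
  have haj : a j < a i := hs hjs hi hlt
  refine ⟨j, hlt, haj, le_antisymm (incLength_lt_incLength hlt haj) ?_⟩
  have := card_le_incLength hmem (fun k hk => Finset.le_max' _ k hk)
    (hs.mono (by simp))
  omega

theorem lt_of_incLength_le {a : Fin n → α} (ha : Function.Injective a) {i j : Fin n}
    (hij : i < j) (h : incLength a j ≤ incLength a i) : a j < a i :=
  (ha.ne hij.ne').lt_of_le (not_lt.1 fun hlt => (incLength_lt_incLength hij hlt).not_ge h)

/-- The last earlier index on the preceding level is below `i` in every sequence with the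
same lengths of increasing subsequences. -/
theorem exists_forced_predecessor {a : Fin n → α} {i : Fin n} (h : 1 < incLength a i) :
    ∃ j < i, incLength a j + 1 = incLength a i ∧
      ∀ c : Fin n → α, Function.Injective c → incLength c = incLength a → c j < c i := by
  classical
  let s := Finset.univ.filter fun j => j < i ∧ incLength a j + 1 = incLength a i
  have hne : s.Nonempty := by
    obtain ⟨j, hj, -, hj'⟩ := exists_incLength_add_one_eq h
    exact ⟨j, by simp [s, hj, hj']⟩
  obtain ⟨hlt, hlen⟩ := (Finset.mem_filter.1 (s.max'_mem hne)).2
  refine ⟨s.max' hne, hlt, hlen, fun c hc hca => ?_⟩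
  obtain ⟨k, hk, hck, hk'⟩ := exists_incLength_add_one_eq (a := c) (i := i) (by rwa [hca])
  rw [hca] at hk'
  -- Values of `c` decrease along a level, so its last index lies at or below `k`, which is below
  -- `i`.
  rcases (s.le_max' k (by simp [s, hk, hk'])).eq_or_lt with heq | hkm
  · rwa [← heq]
  · refine (lt_of_incLength_le hc hkm ?_).trans hck
    rw [hca]
    omega

/-- If `b` satisfies all relations common to the sequences with the same lengths of increasing
subsequences as `a`, then `b` has these lengths as well. -/
theorem incLength_eq_of_forall_lt {a : Fin n → α} {b : Fin n → β}
    (h : ∀ i j, (∀ c : Fin n → α, Function.Injective c → incLength c = incLength a →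
      c i < c j) → b i < b j) : incLength b = incLength a := by
  funext i
  induction i using WellFoundedLT.induction with
  | ind i ih =>
    apply le_antisymm
    · by_contra! hlt
      obtain ⟨j, hj, hbj, hlen⟩ :=
        exists_incLength_add_one_eq ((one_le_incLength a i).trans_lt hlt)
      rw [ih j hj] at hlen
      -- By induction `j` has level at least that of `i` in `a`, which forces `i` below `j`.
      refine hbj.not_gt (h i j fun c hc hca => lt_of_incLength_le hc hj ?_)
      rw [hca]
      omega
    · rcases (one_le_incLength a i).eq_or_lt with heq | hlt
      · exact heq ▸ one_le_incLength b i
      · obtain ⟨j, hj, hlen, hforced⟩ := exists_forced_predecessor hlt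
        have := incLength_lt_incLength hj (h j i hforced)
        rw [ih j hj] at this
        omega

theorem decLength_eq_incLength_toDual (a : Fin n → α) :
    decLength a = incLength (OrderDual.toDual ∘ a) := rfl

end IncLength

/-- The rank of each index under `r` serves as its real value. -/
theorem exists_injective_seqOrder_eq {n : ℕ} {r : Fin n → Fin n → Prop}
    (hr : IsStrictTotalOrder (Fin n) r) :
    ∃ b : Fin n → ℝ, Function.Injective b ∧ seqOrder b = r := by
  classical
  let b : Fin n → ℝ := fun i => ((Finset.univ.filter fun j => r j i).card : ℝ)
  have hb : ∀ {i j}, r i j → b i < b j := by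
    intro i j hij
    refine Nat.cast_lt.2 (Finset.card_lt_card ?_)
    refine Finset.ssubset_iff_of_subset ?_ |>.2 ⟨i, by simpa using hij, ?_⟩
    · intro k hk
      simp only [Finset.mem_filter, Finset.mem_univ, true_and] at hk ⊢
      exact _root_.trans hk hij
    · simpa using irrefl_of r i
  refine ⟨b, fun i j hij => ?_, ?_⟩
  · rcases trichotomous_of r i j with h | h | h
    · exact absurd hij (hb h).ne
    · exact h
    · exact absurd hij (hb h).ne'
  · funext i j
    refine propext ⟨fun hij => ?_, hb⟩
    rcases trichotomous_of r i j with h | rfl | h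
    · exact h
    · exact absurd hij (lt_irrefl _)
    · exact absurd hij (hb h).not_gt

theorem isStrictTotalOrder_seqOrder {α : Type*} [LinearOrder α] {n : ℕ} {a : Fin n → α}
    (ha : Function.Injective a) : IsStrictTotalOrder (Fin n) (seqOrder a) where
  irrefl i := lt_irrefl (a i)
  trans _ _ _ := lt_trans
  trichotomous _ _ h₁ h₂ := ha (le_antisymm (not_lt.1 h₂) (not_lt.1 h₁))

end ErdosSzekeres

open ErdosSzekeres in
theorem theorem2p2 (n : ℕ) (T : Fin n → ℕ × ℕ) (hT : T ∈ ErdosSzekeres.tableaux n) :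
    ErdosSzekeres.generatingOrders T =
      ErdosSzekeres.linearExtensions (ErdosSzekeres.orderPoset T) := by
  ext r
  constructor
  · rintro ⟨a, ha, hT, rfl⟩
    exact ⟨isStrictTotalOrder_seqOrder ha, fun i j hij => hij _ ⟨a, ha, hT, rfl⟩⟩
  · rintro ⟨hr, hext⟩
    obtain ⟨b, hb, rfl⟩ := exists_injective_seqOrder_eq hr
    obtain ⟨a, -, rfl⟩ := hT
    refine ⟨b, hb, ?_, rfl⟩
    have hinc : incLength b = incLength a := by
      refine incLength_eq_of_forall_lt fun i j hij => hext i j ?_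
      rintro _ ⟨c, hc, hca, rfl⟩
      -- `hij` ranges over all sequences with these increasing lengths, which include those
      -- generating the tableau.
      exact hij c hc (funext fun k => congrArg Prod.fst (congrFun hca k))
    have hdec : decLength b = decLength a := by
      rw [decLength_eq_incLength_toDual, decLength_eq_incLength_toDual]
      -- The indices swap because the values are compared in the dual order.
      refine incLength_eq_of_forall_lt fun i j hij => hext j i ?_
      rintro _ ⟨c, hc, hca, rfl⟩
      exact hij (OrderDual.toDual ∘ c) hc (funext fun k => congrArg Prod.snd (congrFun hca k))
    exact funext fun k => Prod.ext (congrFun hinc k) (congrFun hdec k)
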